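/- **Setting.** Let $H=\{x\in\mathbb R^{1,3}:\langle x,x\rangle=1,\ x^0>0\}$ be the upper sheet of the two-sheeted hyperboloid in Minkowski space (signature $(+,-,-,-)$), with its hyperbolic distance $d(x,y)=\operatorname{arcosh}\langle x,y\rangle$ and its invariant volume $dx$ (in terms of the spatial part $p\in\mathbb R^3$ of $x$, $dx=d^3p/\sqrt{1+|p|^2}$). For $\rho>0$ put $$K_\rho(x,y)=\frac{\sin(\rho\,d(x,y))}{\rho\,\sinh d(x,y)},\qquad K_\rho(x,x)=1 .$$ Fix a point $o\in H$ and define $$\Theta_4(\rho_1,\dots,\rho_4)=\frac1{2\pi^2}\int_H\prod_{i=1}^4K_{\rho_i}(o,y)\,dy,$$ $$I_{10}\big((\rho_{ij})_{1\le i<j\le5}\big)=\frac1{2\pi^2}\int_{H^4}\prod_{1\le i<j\le5}K_{\rho_{ij}}(x_i,x_j)\,dx_1\,dx_2\,dx_3\,dx_4,\qquad x_5=o .$$ Let $\mathcal T$ be a nondegenerate finite triangulation of a topological $4$-manifold $M$ with (possibly empty) boundary, that is, a finite simplicial complex, in which every simplex is a face of a $4$-simplex, together with a homeomorphism from its geometric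 realization to $M$. A $3$-simplex of $\mathcal T$ is a boundary $3$-simplex if it lies in exactly one $4$-simplex; a $2$-simplex is a boundary $2$-simplex if it lies in a boundary $3$-simplex, and it is internal otherwise. Label every $2$-simplex $f$ by a real number $\rho_f>0$. For a $3$-simplex $e$ let $\Theta_4(e)$ be $\Theta_4$ evaluated at the labels of its four $2$-simplices. For a $4$-simplex $v$ with vertices $v_1,\dots,v_5$ (enumerated along a fixed total order of the vertices of $\mathcal T$) let $I_{10}(v)$ be $I_{10}$ evaluated at $\rho_{ij}=\rho_{v\setminus\{v_i,v_j\}}$; thus the node $i$ stands for the $3$-simplex of $v$ opposite to $v_i$, and the link $ij$ for the $2$-simplex common to the $3$-simplices $i$ and $j$. **Theorem.** For positive labels the integrals defining $\Theta_4$ and $I_{10}$ converge absolutely, and for every choice of positive labels on the boundary $2$-simplices the state sum $$\mathcal Z=\int_{(0,\infty)^{F}}\ \prod_{f}\rho_f^2\ \prod_{e}\Theta_4(e)\ \prod_{v}I_{10}(v)\ \prod_{f\in F}d\rho_f$$ converges absolutely. Here $F$ is the set of internal $2$-simplices, the integration is over their labels, and the three products run over all $2$-, $3$- and $4$-simplices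 of $\mathcal T$. This holds for every choice of the point $o$ and of the order of the vertices. -/

import Mathlib

open MeasureTheory

noncomputable section

namespace LorentzianBC

/-! ### Hyperbolic space as the upper sheet of the hyperboloid in Minkowski space -/

/-- Minkowski space `ℝ^{1,3}`, with points `(t, p)`, `t` the time and `p` the space component. -/
abbrev Minkowski : Type := ℝ × EuclideanSpace ℝ (Fin 3)

/-- The Minkowski form, of signature `(+, -, -, -)`. -/
def form (x y : Minkowski) : ℝ := x.1 * y.1 - inner ℝ x.2 y.2

/-- The upper sheet `H` of the two-sheeted hyperboloid. -/
def Hyp : Type := {x : Minkowski // form x x = 1 ∧ 0 < x.1}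

instance : TopologicalSpace Hyp := inferInstanceAs (TopologicalSpace (Subtype _))

instance : MeasurableSpace Hyp := inferInstanceAs (MeasurableSpace (Subtype _))

/-- The point of `H` with spatial part `p`. -/
def lift (p : EuclideanSpace ℝ (Fin 3)) : Hyp :=
  ⟨(√(1 + ‖p‖ ^ 2), p), by
    have h : (0 : ℝ) ≤ 1 + ‖p‖ ^ 2 := by positivity
    simp [form, Real.mul_self_sqrt h], Real.sqrt_pos.2 (by positivity)⟩

theorem measurable_lift : Measurable lift :=
  Measurable.subtype_mk (by fun_prop)

/-- The hyperbolic distance: `cosh d(x,y) = ⟨x, y⟩`. -/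
def hdist (x y : Hyp) : ℝ := Real.arcosh (form x.1 y.1)

/-- The invariant volume `d³p / √(1 + |p|²)` on `H`
(in polar coordinates `p = sinh r • ω` it is `sinh² r dr dω`). -/
def hvol : Measure Hyp :=
  Measure.map lift (volume.withDensity fun p => ENNReal.ofReal (1 / √(1 + ‖p‖ ^ 2)))

/-! ### The relativistic spin networks -/

open Classical in
/-- The kernel `K_ρ(x,y) = sin(ρ d) / (ρ sinh d)`, `d = d(x,y)`, extended to the diagonal by its
limit `1`. -/
def kernel (ρ : ℝ) (x y : Hyp) : ℝ :=
  if x = y then 1 else Real.sin (ρ * hdist x y) / (ρ * Real.sinh (hdist x y))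

/-- The integrand of `Θ₄`; the point `x` is not integrated over. -/
def thetaIntegrand (x : Hyp) (ρ : Fin 4 → ℝ) (y : Hyp) : ℝ := ∏ i, kernel (ρ i) x y

/-- The `Θ₄` spin network. -/
def theta4 (x : Hyp) (ρ : Fin 4 → ℝ) : ℝ :=
  1 / (2 * Real.pi ^ 2) * ∫ y, thetaIntegrand x ρ y ∂hvol

/-- The integrand of `I₁₀` as a function of `x₁, …, x₄`; the point `x₅ = o` is not integrated
over. Only the labels `ρ i j` with `i < j` enter. -/
def I10Integrand (o : Hyp) (ρ : Fin 5 → Fin 5 → ℝ) (x : Fin 4 → Hyp) : ℝ :=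
  ∏ p ∈ (Finset.univ : Finset (Fin 5 × Fin 5)) with p.1 < p.2,
    kernel (ρ p.1 p.2) ((Fin.snoc x o : Fin 5 → Hyp) p.1) ((Fin.snoc x o : Fin 5 → Hyp) p.2)

/-- The `I₁₀` spin network. -/
def I10 (o : Hyp) (ρ : Fin 5 → Fin 5 → ℝ) : ℝ :=
  1 / (2 * Real.pi ^ 2) * ∫ x, I10Integrand o ρ x ∂(Measure.pi fun _ : Fin 4 => hvol)

/-! ### Triangulated 4-manifolds -/

section Complex

variable {V : Type*} [Fintype V]

/-- The geometric realization of a complex on a finite vertex set, in barycentric coordinates. -/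
def realization (K : PreAbstractSimplicialComplex V) : Set (V → ℝ) :=
  {w | w ∈ stdSimplex ℝ V ∧ ∃ s ∈ K.faces, ∀ v ∉ s, w v = 0}

/-- `K` is a (finite) triangulation of the topological 4-manifold with (possibly empty) boundary
`M`: a simplicial complex built from 4-simplices whose realization is homeomorphic to `M`. -/
structure IsTriangulation (K : PreAbstractSimplicialComplex V) (M : Type*) [TopologicalSpace M]
    [ChartedSpace (EuclideanHalfSpace 4) M] : Prop where
  pure : ∀ s ∈ K.faces, ∃ t ∈ K.faces, s ⊆ t ∧ t.card = 5
  homeo : Nonempty (realization K ≃ₜ M)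

open Classical in
/-- The `k`-simplices of `K`. -/
def simplices (K : PreAbstractSimplicialComplex V) (k : ℕ) : Finset (Finset V) :=
  Finset.univ.filter fun s => s ∈ K.faces ∧ s.card = k + 1

theorem card_of_mem_simplices {K : PreAbstractSimplicialComplex V} {k : ℕ} {s : Finset V}
    (h : s ∈ simplices K k) : s.card = k + 1 := by
  classical
  exact (Finset.mem_filter.1 h).2.2

open Classical in
/-- The 3-simplices of the boundary: those lying in exactly one 4-simplex. -/
def boundaryTets (K : PreAbstractSimplicialComplex V) : Finset (Finset V) :=
  {e ∈ simplices K 3 | ({v ∈ simplices K 4 | e ⊆ v}).card = 1}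

open Classical in
/-- The 2-simplices belonging to the boundary. -/
def boundaryFaces (K : PreAbstractSimplicialComplex V) : Finset (Finset V) :=
  {f ∈ simplices K 2 | ∃ e ∈ boundaryTets K, f ⊆ e}

open Classical in
/-- The internal 2-simplices. -/
def internalFaces (K : PreAbstractSimplicialComplex V) : Finset (Finset V) :=
  {f ∈ simplices K 2 | f ∉ boundaryFaces K}

/-! ### The state sum -/

open Classical in
/-- The labelling which is `ρ` on internal 2-simplices and `β` on boundary 2-simplices. -/
def label (K : PreAbstractSimplicialComplex V) (β : boundaryFaces K → ℝ)
    (ρ : internalFaces K → ℝ) (f : Finset V) : ℝ :=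
  if h : f ∈ internalFaces K then ρ ⟨f, h⟩
  else if h : f ∈ boundaryFaces K then β ⟨f, h⟩ else 0

/-- The amplitude of a 3-simplex `e` with labelling `l`: its four 2-simplices are obtained by
deleting one vertex. -/
def tetAmplitude [LinearOrder V] (o : Hyp) (l : Finset V → ℝ) (e : Finset V)
    (he : e.card = 4) : ℝ :=
  theta4 o fun i => l (e.erase (e.orderEmbOfFin he i))

/-- The amplitude of a 4-simplex `v` with labelling `l`: the node `i` of the spin network stands
for the 3-simplex of `v` opposite to the `i`-th vertex, and the link `i j` for the 2-simplex shared
by the 3-simplices `i` and `j`. -/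
def simplexAmplitude [LinearOrder V] (o : Hyp) (l : Finset V → ℝ) (v : Finset V)
    (hv : v.card = 5) : ℝ :=
  I10 o fun i j => l ((v.erase (v.orderEmbOfFin hv i)).erase (v.orderEmbOfFin hv j))

/-- The integrand of the state sum, a function of the labels `ρ` of the internal 2-simplices,
for given labels `β` of the boundary 2-simplices. -/
def stateSumIntegrand [LinearOrder V] (K : PreAbstractSimplicialComplex V) (o : Hyp)
    (β : boundaryFaces K → ℝ) (ρ : internalFaces K → ℝ) : ℝ :=
  (∏ f ∈ simplices K 2, label K β ρ f ^ 2) *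
  (∏ e : simplices K 3, tetAmplitude o (label K β ρ) e.1 (card_of_mem_simplices e.2)) *
  ∏ v : simplices K 4, simplexAmplitude o (label K β ρ) v.1 (card_of_mem_simplices v.2)

end Complex

end LorentzianBC

end

/-!
The proof bounds the kernel by `|K_ρ| ≤ 1` and by `|K_ρ| ≤ min(1, 1/ρ) κ` with `κ = (1 + d) / sinh d`
(`enorm_kernel_le_one`, `enorm_kernel_le`). The function `κ` is of order `1/d` at `d = 0` and of order
`d e^{-d}` at infinity, while balls of `H` have volume of order `e^{2d}`. Hence `κ^{5/2}` is integrable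
over `H`, with an integral that is the same from every point of `H`, by Lorentz invariance
(`lintegral_majorant`, `majorantIntegral_lt_top`).

Everything reduces to this one integral. For `Θ₄`, interpolation of the two bounds gives
`|K_ρ| ≤ (min(1, 1/ρ) κ)^{5/8}`, so that the product of the four kernels is dominated by `κ^{5/2}` and
`|Θ₄| ≤ C ∏ min(1, 1/ρᵢ)^{5/8}` (`enorm_theta4_le`). For `I₁₀`, every edge of the complete graph on five
vertices lies in the stars of two vertices, so the product of `κ` over the ten edges is at most the
`5/2`-th power of its product over the largest star (`prod_edges_le_sum_stars`). A star is a spanning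
tree, and integrates to the fourth power of the integral of `κ^{5/2}`; hence
`|I₁₀| ≤ C ∏ min(1, 1/ρᵢⱼ)` (`enorm_I10_le`).

An internal 2-simplex lies in at least three 3-simplices and three 4-simplices: in its link, which is a
graph, every vertex has degree at least two (`three_le_card_of_mem_internalFaces`). The integrand of
the state sum is thus dominated by a product over the internal 2-simplices of functions of a single
label `r`, bounded near `0` and at infinity of order `r ^ (2 - 3 - 15/8)`, which are integrable
(`lintegral_labelBound_lt_top`).
-/

namespace LorentzianBC

open scoped ENNReal

/-! ### Pointwise bounds for the kernel -/

theorem form_comm (x y : Minkowski) : form x y = form y x := by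
  simp [form, mul_comm, real_inner_comm]

/-- The reversed Cauchy–Schwarz inequality on the hyperboloid. -/
theorem one_le_form (x y : Hyp) : 1 ≤ form x.1 y.1 := by
  obtain ⟨⟨s, p⟩, hx, hs⟩ := x
  obtain ⟨⟨t, q⟩, hy, ht⟩ := y
  simp only [form, real_inner_self_eq_norm_sq] at hx hy hs ht ⊢
  have hpq := real_inner_le_norm p q
  have hle : 1 + ‖p‖ * ‖q‖ ≤ s * t := by
    refine abs_le_of_sq_le_sq' ?_ (by positivity) |>.2
    nlinarith [sq_nonneg (‖p‖ - ‖q‖)]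
  linarith

theorem hdist_nonneg (x y : Hyp) : 0 ≤ hdist x y := Real.arcosh_nonneg (one_le_form x y)

theorem hdist_self (x : Hyp) : hdist x x = 0 := by
  simp [hdist, x.2.1]

/-- The decay factor `min(1, 1/ρ)` of the kernel in its label, with the value `1` for `ρ ≤ 0`. -/
noncomputable def cutoff (ρ : ℝ) : ℝ≥0∞ := min 1 (ENNReal.ofReal ρ)⁻¹

theorem cutoff_le_one (ρ : ℝ) : cutoff ρ ≤ 1 := min_le_left _ _

theorem cutoff_ne_zero (ρ : ℝ) : cutoff ρ ≠ 0 := by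
  simp [cutoff, min_eq_iff]

theorem cutoff_eq_ofReal {ρ : ℝ} (hρ : 0 < ρ) : cutoff ρ = ENNReal.ofReal (min 1 ρ⁻¹) := by
  rw [cutoff, ENNReal.ofReal_min, ENNReal.ofReal_one, ENNReal.ofReal_inv_of_pos hρ]

theorem measurable_cutoff : Measurable cutoff := by
  unfold cutoff; fun_prop

/-- The function `(1 + d) / sinh d` of `cosh d`, which dominates all the kernels. At `d = 0` it
takes the value `∞`. -/
noncomputable def majorant (c : ℝ) : ℝ≥0∞ :=
  ENNReal.ofReal (1 + Real.arcosh c) / ENNReal.ofReal (Real.sinh (Real.arcosh c))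

theorem measurable_arcosh : Measurable Real.arcosh := by
  unfold Real.arcosh; fun_prop

theorem measurable_majorant : Measurable majorant := by
  have := measurable_arcosh
  unfold majorant; fun_prop

theorem enorm_kernel_le_one (ρ : ℝ) (x y : Hyp) : ‖kernel ρ x y‖ₑ ≤ 1 := by
  rw [← enorm_one (G := ℝ), enorm_le_iff_norm_le, norm_one, Real.norm_eq_abs, kernel]
  split_ifs
  · simp
  · have hd := hdist_nonneg x y
    rw [abs_div]
    refine div_le_one_of_le₀ (Real.abs_sin_le_abs.trans ?_) (abs_nonneg _)
    rw [abs_mul, abs_mul]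
    refine mul_le_mul_of_nonneg_left ?_ (abs_nonneg _)
    rw [abs_of_nonneg hd]
    exact (Real.self_le_sinh_iff.2 hd).trans (le_abs_self _)

theorem enorm_kernel_le (ρ : ℝ) (x y : Hyp) :
    ‖kernel ρ x y‖ₑ ≤ cutoff ρ * majorant (form x.1 y.1) := by
  have hd := hdist_nonneg x y
  change _ ≤ cutoff ρ * (ENNReal.ofReal (1 + hdist x y) / ENNReal.ofReal (Real.sinh (hdist x y)))
  rcases hd.eq_or_lt with h0 | hpos
  · -- the right-hand side is infinite; this case includes the diagonal `x = y`
    rw [← h0]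
    simp [ENNReal.mul_top (cutoff_ne_zero ρ)]
  · have hne : x ≠ y := by
      rintro rfl
      exact hpos.ne' (hdist_self x)
    have hs : 0 < Real.sinh (hdist x y) := Real.sinh_pos_iff.2 hpos
    rw [kernel, if_neg hne, Real.enorm_eq_ofReal_abs, cutoff]
    rw [← ENNReal.ofReal_div_of_pos hs, ← div_div, abs_div, abs_of_pos hs]
    -- the numerator is at most `min (d, 1/ρ)`
    have h1 : |Real.sin (ρ * hdist x y) / ρ| ≤ hdist x y := by
      rw [abs_div]
      refine div_le_of_le_mul₀ (abs_nonneg _) hd ?_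
      refine Real.abs_sin_le_abs.trans ?_
      rw [abs_mul, abs_of_nonneg hd, mul_comm]
    rw [min_def]
    split_ifs with hρ
    · rw [one_mul]
      refine ENNReal.ofReal_le_ofReal ?_
      gcongr
      linarith
    · have hρ1 : 1 < ENNReal.ofReal ρ := by
        rw [← ENNReal.inv_lt_one]; exact not_le.1 hρ
      have hρ0 : 0 < ρ := ENNReal.ofReal_pos.1 (zero_lt_one.trans hρ1)
      rw [← ENNReal.ofReal_inv_of_pos hρ0, ← ENNReal.ofReal_mul (by positivity)]
      refine ENNReal.ofReal_le_ofReal ?_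
      rw [← mul_div_assoc]
      gcongr
      rw [abs_div, abs_of_pos hρ0, div_eq_inv_mul]
      gcongr
      linarith [Real.abs_sin_le_one (ρ * hdist x y)]

theorem measurable_form :
    Measurable fun z : Hyp × Hyp => form z.1.1 z.2.1 := by
  have h1 : Measurable fun z : Hyp × Hyp => z.1.1 := measurable_subtype_coe.comp measurable_fst
  have h2 : Measurable fun z : Hyp × Hyp => z.2.1 := measurable_subtype_coe.comp measurable_snd
  unfold form
  exact (h1.fst.mul h2.fst).sub (h1.snd.inner h2.snd)

theorem measurable_kernel :
    Measurable fun z : ℝ × Hyp × Hyp => kernel z.1 z.2.1 z.2.2 := by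
  classical
  have hd : Measurable fun z : ℝ × Hyp × Hyp => hdist z.2.1 z.2.2 :=
    measurable_arcosh.comp (measurable_form.comp measurable_snd)
  have hx : Measurable fun z : ℝ × Hyp × Hyp => z.2.1.1 :=
    measurable_subtype_coe.comp measurable_snd.fst
  have hy : Measurable fun z : ℝ × Hyp × Hyp => z.2.2.1 :=
    measurable_subtype_coe.comp measurable_snd.snd
  have hS : MeasurableSet {z : ℝ × Hyp × Hyp | z.2.1 = z.2.2} := by
    have := measurableSet_eq_fun hx hy
    convert this using 3
    exact Subtype.ext_iff
  unfold kernel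
  refine Measurable.ite (by convert hS) measurable_const ?_
  exact (Real.measurable_sin.comp (measurable_fst.mul hd)).div
    (measurable_fst.mul (Real.measurable_sinh.comp hd))

theorem _root_.Measurable.kernel {α : Type*} [MeasurableSpace α] {f : α → ℝ} {g h : α → Hyp}
    (hf : Measurable f) (hg : Measurable g) (hh : Measurable h) :
    Measurable fun a => LorentzianBC.kernel (f a) (g a) (h a) :=
  measurable_kernel.comp (hf.prodMk (hg.prodMk hh))

/-! ### Integration over hyperbolic space -/

theorem lintegral_hvol {h : Hyp → ℝ≥0∞} (hh : Measurable h) :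
    ∫⁻ y, h y ∂hvol = ∫⁻ p, ENNReal.ofReal (1 / √(1 + ‖p‖ ^ 2)) * h (lift p) := by
  rw [hvol, lintegral_map hh measurable_lift]
  exact lintegral_withDensity_eq_lintegral_mul _ (by fun_prop) (hh.comp measurable_lift)

theorem lift_snd (x : Hyp) : lift x.1.2 = x := by
  obtain ⟨⟨t, p⟩, hx, ht⟩ := x
  simp only [form, real_inner_self_eq_norm_sq] at hx ht
  refine Subtype.ext (Prod.ext ?_ rfl)
  change √(1 + ‖p‖ ^ 2) = t
  rw [show 1 + ‖p‖ ^ 2 = t ^ 2 by linarith, Real.sqrt_sq ht.le]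

instance : SigmaFinite hvol := by
  let e : EuclideanSpace ℝ (Fin 3) ≃ᵐ Hyp :=
    { toFun := lift
      invFun := fun x => x.1.2
      left_inv := fun _ => rfl
      right_inv := lift_snd
      measurable_toFun := measurable_lift
      measurable_invFun := measurable_subtype_coe.snd }
  exact e.sigmaFinite_map

/-- In the rapidity `u` along the direction of a boost, the boost acts by translation. The
substitution is `s = m sinh (u + χ)`, where `χ` is the rapidity of the boost. -/
theorem lintegral_boost (g : ℝ → ℝ≥0∞) {m : ℝ} (hm : 0 < m) (a : ℝ) :
    ∫⁻ s : ℝ, ENNReal.ofReal (1 / √(m ^ 2 + s ^ 2)) *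
        g (√(1 + a ^ 2) * √(m ^ 2 + s ^ 2) - a * s) =
      ∫⁻ u : ℝ, g (m * Real.cosh u) := by
  obtain ⟨χ, rfl⟩ : ∃ χ, Real.sinh χ = a := ⟨_, Real.sinh_arsinh a⟩
  have hC : √(1 + Real.sinh χ ^ 2) = Real.cosh χ := by
    rw [add_comm, ← Real.cosh_sq, Real.sqrt_sq (Real.cosh_pos _).le]
  have hr (u : ℝ) : √(m ^ 2 + (m * Real.sinh u) ^ 2) = m * Real.cosh u := by
    rw [← Real.sqrt_sq (mul_pos hm (Real.cosh_pos u)).le]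
    congr 1
    linear_combination (-m ^ 2) * Real.cosh_sq u
  have hd (u : ℝ) : HasDerivAt (fun u => m * Real.sinh (u + χ)) (m * Real.cosh (u + χ)) u := by
    simpa using (((hasDerivAt_id u).add_const χ).sinh).const_mul m
  have hinj : Function.Injective fun u => m * Real.sinh (u + χ) := fun u v h => by
    simpa [hm.ne'] using h
  have hsurj : Function.Surjective fun u => m * Real.sinh (u + χ) := fun s =>
    ⟨Real.arsinh (s / m) - χ, by simp [mul_div_cancel₀ _ hm.ne']⟩
  have key := lintegral_image_eq_lintegral_abs_deriv_mul MeasurableSet.univ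
    (fun u _ => (hd u).hasDerivWithinAt) hinj.injOn
    (fun s => ENNReal.ofReal (1 / √(m ^ 2 + s ^ 2)) *
      g (√(1 + Real.sinh χ ^ 2) * √(m ^ 2 + s ^ 2) - Real.sinh χ * s))
  rw [Set.image_univ, hsurj.range_eq, setLIntegral_univ, setLIntegral_univ] at key
  rw [key]
  refine lintegral_congr fun u => ?_
  have hpos : 0 < m * Real.cosh (u + χ) := mul_pos hm (Real.cosh_pos _)
  rw [hr, hC, abs_of_pos hpos, ← mul_assoc, ← ENNReal.ofReal_mul hpos.le,
    mul_one_div_cancel hpos.ne', ENNReal.ofReal_one, one_mul]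
  congr 1
  have := Real.cosh_sub (u + χ) χ
  rw [add_sub_cancel_right] at this
  rw [this]
  ring

/-- The splitting of the spatial part into its components along and orthogonal to a unit vector. -/
theorem exists_measurePreserving_split (q : EuclideanSpace ℝ (Fin 3)) :
    ∃ Φ : EuclideanSpace ℝ (Fin 3) → ℝ × (Fin 2 → ℝ), MeasurePreserving Φ ∧
      ∀ p, inner ℝ q p = ‖q‖ * (Φ p).1 ∧ ‖p‖ ^ 2 = (Φ p).1 ^ 2 + ∑ j, (Φ p).2 j ^ 2 := by
  obtain ⟨e, he, hqe⟩ : ∃ e : EuclideanSpace ℝ (Fin 3), ‖e‖ = 1 ∧ q = ‖q‖ • e := by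
    by_cases hq : q = 0
    · exact ⟨EuclideanSpace.single 0 1, by simp, by simp [hq]⟩
    · have : ‖q‖ ≠ 0 := norm_ne_zero_iff.2 hq
      exact ⟨‖q‖⁻¹ • q, by simp [norm_smul, this], by simp [smul_smul, this]⟩
  obtain ⟨b, hb⟩ := Orthonormal.exists_orthonormalBasis_extension_of_card_eq (𝕜 := ℝ)
    (ι := Fin 3) (E := EuclideanSpace ℝ (Fin 3)) (by simp) (v := fun _ => e) (s := {0})
    (by
      rw [orthonormal_iff_ite]
      rintro ⟨i, rfl⟩ ⟨j, rfl⟩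
      simp [he])
  have hb0 : b 0 = e := hb 0 rfl
  refine ⟨fun p => MeasurableEquiv.piFinSuccAbove (fun _ => ℝ) 0 (WithLp.ofLp (b.repr p)),
    (volume_preserving_piFinSuccAbove (fun _ => ℝ) 0).comp
      ((PiLp.volume_preserving_ofLp _).comp b.measurePreserving_repr), fun p => ⟨?_, ?_⟩⟩
  · change _ = ‖q‖ * b.repr p 0
    rw [b.repr_apply_apply, hb0, ← real_inner_smul_left, ← hqe]
  · rw [← b.repr.norm_map p, EuclideanSpace.norm_sq_eq, Fin.sum_univ_succ]
    simp [MeasurableEquiv.piFinSuccAbove]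
    rfl

/-- An integral over `H` of a function of the distance to `x`, in terms of the component of the
spatial part along that of `x`. The right-hand side no longer depends on `x`. -/
theorem lintegral_form {g : ℝ → ℝ≥0∞} (hg : Measurable g) (x : Hyp) :
    ∫⁻ y, g (form x.1 y.1) ∂hvol =
      ∫⁻ w : Fin 2 → ℝ, ∫⁻ u : ℝ, g (√(1 + ∑ j, w j ^ 2) * Real.cosh u) := by
  have hm : Measurable fun y : Hyp => g (form x.1 y.1) :=
    hg.comp (measurable_form.comp (measurable_const.prodMk measurable_id))
  rw [lintegral_hvol hm]
  obtain ⟨Φ, hΦ, hΦ'⟩ := exists_measurePreserving_split x.1.2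
  set F : ℝ × (Fin 2 → ℝ) → ℝ≥0∞ := fun z =>
    ENNReal.ofReal (1 / √(√(1 + ∑ j, z.2 j ^ 2) ^ 2 + z.1 ^ 2)) *
      g (√(1 + ‖x.1.2‖ ^ 2) * √(√(1 + ∑ j, z.2 j ^ 2) ^ 2 + z.1 ^ 2) - ‖x.1.2‖ * z.1) with hF
  have hFm : Measurable F := by
    refine Measurable.mul (by fun_prop) (hg.comp (by fun_prop))
  have hpos (w : Fin 2 → ℝ) : 0 < 1 + ∑ j, w j ^ 2 := by positivity
  have hcomp (p) : ENNReal.ofReal (1 / √(1 + ‖p‖ ^ 2)) * g (form x.1 (lift p).1) = F (Φ p) := by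
    have h1 : 1 + ‖p‖ ^ 2 = √(1 + ∑ j, (Φ p).2 j ^ 2) ^ 2 + (Φ p).1 ^ 2 := by
      rw [Real.sq_sqrt (hpos _).le, (hΦ' p).2]; ring
    have h2 : form x.1 (lift p).1 =
        √(1 + ‖x.1.2‖ ^ 2) * √(1 + ‖p‖ ^ 2) - ‖x.1.2‖ * (Φ p).1 := by
      rw [← (hΦ' p).1]
      exact congrArg (fun z : Hyp => form z.1 (lift p).1) (lift_snd x).symm
    rw [h2, h1]
  simp_rw [hcomp]
  rw [hΦ.lintegral_comp hFm, Measure.volume_eq_prod, lintegral_prod_symm _ hFm.aemeasurable]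
  exact lintegral_congr fun w => lintegral_boost g (Real.sqrt_pos.2 (hpos w)) _

/-! ### Integrability of a power of the majorant -/

/-- The radial integrand of `majorant ^ (5/2)`, in terms of `s = sinh d`: it is of order `s ^ (-1/2)`
at `0`, and up to a power of a logarithm of order `s ^ (-3/2)` at infinity. -/
theorem integrableOn_radial_majorant :
    IntegrableOn (fun s : ℝ => s ^ 2 *
      (1 / √(1 + s ^ 2) * ((1 + Real.arsinh s) / s) ^ (5 / 2 : ℝ))) (Set.Ioi 0) := by
  have hmeas : Measurable fun s : ℝ => s ^ 2 *
      (1 / √(1 + s ^ 2) * ((1 + Real.arsinh s) / s) ^ (5 / 2 : ℝ)) := by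
    have := Real.continuous_arsinh.measurable
    fun_prop
  rw [← Set.Ioc_union_Ioi_eq_Ioi zero_le_one, integrableOn_union]
  constructor
  · have hint : IntegrableOn (fun s : ℝ => 2 ^ (5 / 2 : ℝ) * s ^ (-1 / 2 : ℝ)) (Set.Ioc 0 1) := by
      refine Integrable.const_mul ?_ _
      rw [← IntegrableOn, ← intervalIntegrable_iff_integrableOn_Ioc_of_le zero_le_one]
      exact intervalIntegral.intervalIntegrable_rpow' (by norm_num)
    refine Integrable.mono' hint hmeas.aestronglyMeasurable ?_
    filter_upwards [self_mem_ae_restrict measurableSet_Ioc] with s ⟨hs0, hs1⟩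
    have hL0 : 0 ≤ Real.arsinh s := Real.arsinh_nonneg_iff.2 hs0.le
    have hL1 : Real.arsinh s ≤ s := by
      simpa using Real.self_le_sinh_iff.2 hL0
    rw [Real.norm_of_nonneg (by positivity)]
    have h1 : 1 / √(1 + s ^ 2) ≤ 1 := by
      rw [div_le_one (by positivity), Real.one_le_sqrt]
      nlinarith
    calc s ^ 2 * (1 / √(1 + s ^ 2) * ((1 + Real.arsinh s) / s) ^ (5 / 2 : ℝ))
        ≤ s ^ 2 * (1 * (2 / s) ^ (5 / 2 : ℝ)) := by
          gcongr
          linarith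
      _ = 2 ^ (5 / 2 : ℝ) * s ^ (-1 / 2 : ℝ) := by
          rw [Real.div_rpow zero_le_two hs0.le, one_mul, mul_div_left_comm, ← Real.rpow_natCast,
            ← Real.rpow_sub hs0]
          norm_num
  · have hint : IntegrableOn (fun s : ℝ => 13 ^ (5 / 2 : ℝ) * s ^ (-5 / 4 : ℝ)) (Set.Ioi 1) := by
      refine Integrable.const_mul ?_ _
      exact integrableOn_Ioi_rpow_of_lt (by norm_num) zero_lt_one
    refine Integrable.mono' hint hmeas.aestronglyMeasurable ?_
    filter_upwards [self_mem_ae_restrict measurableSet_Ioi] with s hs1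
    have hs1 : 1 < s := hs1
    have hs0 : 0 < s := zero_lt_one.trans hs1
    have hL0 : 0 ≤ Real.arsinh s := Real.arsinh_nonneg_iff.2 hs0.le
    -- the logarithm is absorbed by a power small enough to keep the exponent below `-1`
    have hL1 : 1 + Real.arsinh s ≤ 13 * s ^ (1 / 10 : ℝ) := by
      have h2 : √(1 + s ^ 2) ≤ 2 * s := by
        rw [Real.sqrt_le_left (by positivity)]
        nlinarith
      have h3 : Real.arsinh s ≤ Real.log 3 + Real.log s := by
        rw [← Real.log_mul (by norm_num) hs0.ne']
        exact Real.log_le_log (by positivity) (by linarith)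
      have h4 := Real.log_le_rpow_div hs0.le (show (0 : ℝ) < 1 / 10 by norm_num)
      have h5 : Real.log 3 ≤ 2 := by
        have := Real.log_le_sub_one_of_pos (show (0 : ℝ) < 3 by norm_num)
        linarith
      have h6 : (1 : ℝ) ≤ s ^ (1 / 10 : ℝ) := Real.one_le_rpow hs1.le (by norm_num)
      linarith
    rw [Real.norm_of_nonneg (by positivity)]
    have h1 : 1 / √(1 + s ^ 2) ≤ 1 / s := by
      gcongr
      exact Real.le_sqrt_of_sq_le (by linarith)
    calc s ^ 2 * (1 / √(1 + s ^ 2) * ((1 + Real.arsinh s) / s) ^ (5 / 2 : ℝ))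
        ≤ s ^ 2 * (1 / s * (13 * s ^ (1 / 10 : ℝ) / s) ^ (5 / 2 : ℝ)) := by
          gcongr
      _ = 13 ^ (5 / 2 : ℝ) * s ^ (-5 / 4 : ℝ) := by
          rw [mul_div_assoc, ← Real.rpow_sub_one hs0.ne', Real.mul_rpow (by norm_num)
            (by positivity), ← Real.rpow_mul hs0.le, one_div, ← Real.rpow_neg_one s,
            ← Real.rpow_natCast s 2, mul_left_comm (s ^ (-1 : ℝ)), mul_left_comm,
            ← Real.rpow_add hs0, ← Real.rpow_add hs0]
          norm_num

/-- The integral over `H` of `majorant ^ (5/2)`, as a function of the distance to a fixed point. It is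
written in coordinates that make no reference to the point. -/
noncomputable def majorantIntegral : ℝ≥0∞ :=
  ∫⁻ w : Fin 2 → ℝ, ∫⁻ u : ℝ, majorant (√(1 + ∑ j, w j ^ 2) * Real.cosh u) ^ (5 / 2 : ℝ)

theorem lintegral_majorant (x : Hyp) :
    ∫⁻ y, majorant (form x.1 y.1) ^ (5 / 2 : ℝ) ∂hvol = majorantIntegral :=
  lintegral_form (measurable_majorant.pow_const _) x

theorem majorantIntegral_lt_top : majorantIntegral < ∞ := by
  have hm : Measurable fun y : Hyp => majorant (form (lift 0).1 y.1) ^ (5 / 2 : ℝ) :=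
    (measurable_majorant.comp
      (measurable_form.comp (measurable_const.prodMk measurable_id))).pow_const _
  rw [← lintegral_majorant (lift 0), lintegral_hvol hm]
  have hint := (integrable_fun_norm_addHaar (volume : Measure (EuclideanSpace ℝ (Fin 3)))
    (f := fun s : ℝ => 1 / √(1 + s ^ 2) * ((1 + Real.arsinh s) / s) ^ (5 / 2 : ℝ))).2 (by
      simpa using integrableOn_radial_majorant)
  refine lt_of_eq_of_lt (lintegral_congr_ae ?_) hint.lintegral_lt_top
  filter_upwards [Measure.ae_ne volume (0 : EuclideanSpace ℝ (Fin 3))] with p hp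
  have hp : 0 < ‖p‖ := norm_pos_iff.2 hp
  have hform : form (lift 0).1 (lift p).1 = √(1 + ‖p‖ ^ 2) := by simp [form, lift]
  have hd : Real.arcosh √(1 + ‖p‖ ^ 2) = Real.arsinh ‖p‖ := by
    rw [← Real.cosh_arsinh, Real.arcosh_cosh (Real.arsinh_nonneg_iff.2 hp.le)]
  have hL : 0 ≤ Real.arsinh ‖p‖ := Real.arsinh_nonneg_iff.2 hp.le
  rw [hform, majorant, hd, Real.sinh_arsinh, ← ENNReal.ofReal_div_of_pos hp,
    ENNReal.ofReal_rpow_of_nonneg (by positivity) (by norm_num), ENNReal.ofReal_mul (by positivity)]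

/-! ### The bound for `Θ₄` -/

theorem enorm_prod_real {ι : Type*} (s : Finset ι) (f : ι → ℝ) :
    ‖∏ i ∈ s, f i‖ₑ = ∏ i ∈ s, ‖f i‖ₑ := by
  simp [enorm, nnnorm_prod]

theorem enorm_thetaIntegrand_le (x : Hyp) (ρ : Fin 4 → ℝ) (y : Hyp) :
    ‖thetaIntegrand x ρ y‖ₑ ≤
      (∏ i, cutoff (ρ i)) ^ (5 / 8 : ℝ) * majorant (form x.1 y.1) ^ (5 / 2 : ℝ) := by
  -- interpolation between the two bounds for the kernel, the exponent `5/8` being `(5/2) / 4`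
  have h (i) : ‖kernel (ρ i) x y‖ₑ ≤ (cutoff (ρ i) * majorant (form x.1 y.1)) ^ (5 / 8 : ℝ) :=
    calc ‖kernel (ρ i) x y‖ₑ = ‖kernel (ρ i) x y‖ₑ ^ (1 : ℝ) := (ENNReal.rpow_one _).symm
      _ ≤ ‖kernel (ρ i) x y‖ₑ ^ (5 / 8 : ℝ) :=
        ENNReal.rpow_le_rpow_of_exponent_ge (enorm_kernel_le_one _ _ _) (by norm_num)
      _ ≤ _ := by gcongr; exact enorm_kernel_le _ _ _
  rw [thetaIntegrand, enorm_prod_real]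
  refine (Finset.prod_le_prod' fun i _ => h i).trans_eq ?_
  rw [ENNReal.prod_rpow_of_nonneg (by norm_num), Finset.prod_mul_distrib,
    ENNReal.mul_rpow_of_nonneg _ _ (by norm_num), Finset.prod_const, ← ENNReal.rpow_natCast,
    ← ENNReal.rpow_mul]
  norm_num

theorem lintegral_thetaIntegrand_le (x : Hyp) (ρ : Fin 4 → ℝ) :
    ∫⁻ y, ‖thetaIntegrand x ρ y‖ₑ ∂hvol ≤
      (∏ i, cutoff (ρ i)) ^ (5 / 8 : ℝ) * majorantIntegral := by
  rw [← lintegral_majorant x, ← lintegral_const_mul]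
  · exact lintegral_mono fun y => enorm_thetaIntegrand_le x ρ y
  · exact (measurable_majorant.comp
      (measurable_form.comp (measurable_const.prodMk measurable_id))).pow_const _

theorem prod_cutoff_le_one {ι : Type*} (s : Finset ι) (ρ : ι → ℝ) : ∏ i ∈ s, cutoff (ρ i) ≤ 1 :=
  Finset.prod_le_one' fun _ _ => cutoff_le_one _

theorem measurable_thetaIntegrand (x : Hyp) :
    Measurable fun z : (Fin 4 → ℝ) × Hyp => thetaIntegrand x z.1 z.2 := by
  unfold thetaIntegrand
  exact Finset.measurable_fun_prod _ fun i _ =>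
    ((measurable_pi_apply i).comp measurable_fst).kernel measurable_const measurable_snd

theorem integrable_thetaIntegrand (x : Hyp) (ρ : Fin 4 → ℝ) :
    Integrable (thetaIntegrand x ρ) hvol := by
  refine ⟨((measurable_thetaIntegrand x).comp measurable_prodMk_left).aestronglyMeasurable, ?_⟩
  refine (lintegral_thetaIntegrand_le x ρ).trans_lt (ENNReal.mul_lt_top ?_ majorantIntegral_lt_top)
  exact (ENNReal.rpow_le_one (prod_cutoff_le_one _ _) (by norm_num)).trans_lt ENNReal.one_lt_top

theorem enorm_theta4_le (x : Hyp) (ρ : Fin 4 → ℝ) :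
    ‖theta4 x ρ‖ₑ ≤ ‖1 / (2 * Real.pi ^ 2)‖ₑ *
      ((∏ i, cutoff (ρ i)) ^ (5 / 8 : ℝ) * majorantIntegral) := by
  rw [theta4, enorm_mul]
  gcongr
  exact (enorm_integral_le_lintegral_enorm _).trans (lintegral_thetaIntegrand_le x ρ)

theorem measurable_theta4 (x : Hyp) : Measurable (theta4 x) :=
  ((measurable_thetaIntegrand x).stronglyMeasurable.integral_prod_right.measurable).const_mul _

/-! ### The bound for `I₁₀` -/

/-- Each edge of the complete graph on five vertices belongs to the stars of its two end points, so
the square of the product over all edges is the product over the five stars. It is therefore at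
most the fifth power of the largest star. -/
theorem prod_edges_le_sum_stars (κ : Fin 5 → Fin 5 → ℝ≥0∞) (hκ : ∀ i j, κ i j = κ j i) :
    ∏ p ∈ (Finset.univ : Finset (Fin 5 × Fin 5)) with p.1 < p.2, κ p.1 p.2 ≤
      ∑ i, ∏ j : Fin 4, κ i (i.succAbove j) ^ (5 / 2 : ℝ) := by
  set Q := ∏ p ∈ (Finset.univ : Finset (Fin 5 × Fin 5)) with p.1 < p.2, κ p.1 p.2 with hQ
  set P : Fin 5 → ℝ≥0∞ := fun i => ∏ j : Fin 4, κ i (i.succAbove j) with hP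
  have hsq : Q * Q = ∏ i, P i := by
    have h1 (i) : P i = ∏ j, if i = j then 1 else κ i j := by
      rw [Fin.prod_univ_succAbove _ i]
      simp [hP, (Fin.succAbove_ne i _).symm]
    have h2 : Q = ∏ p ∈ (Finset.univ : Finset (Fin 5 × Fin 5)) with p.2 < p.1, κ p.1 p.2 :=
      Finset.prod_nbij' Prod.swap Prod.swap (by simp) (by simp) (by simp) (by simp)
        (fun p _ => hκ _ _)
    simp_rw [h1]
    rw [← Fintype.prod_prod_type']
    nth_rewrite 2 [h2]
    rw [hQ, Finset.prod_filter, Finset.prod_filter, ← Finset.prod_mul_distrib]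
    refine Finset.prod_congr rfl fun p _ => ?_
    rcases lt_trichotomy p.1 p.2 with h | h | h
    · simp [h, h.not_gt, h.ne]
    · simp [h]
    · simp [h, h.not_gt, h.ne']
  obtain ⟨i, -, hi⟩ := Finset.exists_max_image Finset.univ P Finset.univ_nonempty
  have hle : Q ^ (2 : ℝ) ≤ P i ^ (5 : ℝ) := by
    calc Q ^ (2 : ℝ) = Q * Q := by rw [ENNReal.rpow_two, sq]
      _ = ∏ i, P i := hsq
      _ ≤ ∏ _j : Fin 5, P i := Finset.prod_le_prod' fun j _ => hi j (Finset.mem_univ j)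
      _ = P i ^ (5 : ℝ) := by
        rw [Finset.prod_const, Finset.card_univ, Fintype.card_fin]
        exact_mod_cast (ENNReal.rpow_natCast (P i) 5).symm
  calc Q = (Q ^ (2 : ℝ)) ^ (1 / 2 : ℝ) := by rw [← ENNReal.rpow_mul]; norm_num
    _ ≤ (P i ^ (5 : ℝ)) ^ (1 / 2 : ℝ) := by gcongr
    _ = ∏ j : Fin 4, κ i (i.succAbove j) ^ (5 / 2 : ℝ) := by
      rw [← ENNReal.rpow_mul, ENNReal.prod_rpow_of_nonneg (by norm_num)]
      norm_num [hP]
    _ ≤ _ := Finset.single_le_sum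
      (f := fun i : Fin 5 => ∏ j : Fin 4, κ i (i.succAbove j) ^ (5 / 2 : ℝ))
      (fun _ _ => zero_le) (Finset.mem_univ i)

theorem lintegral_pi_succAbove {α : Type*} [MeasurableSpace α] (μ : Measure α) [SigmaFinite μ]
    {n : ℕ} (k : Fin (n + 1)) {F : α → (Fin n → α) → ℝ≥0∞} (hF : Measurable (Function.uncurry F)) :
    ∫⁻ x : Fin (n + 1) → α, F (x k) (fun j => x (k.succAbove j)) ∂(Measure.pi fun _ => μ) =
      ∫⁻ a, ∫⁻ y, F a y ∂(Measure.pi fun _ => μ) ∂μ :=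
  ((measurePreserving_piFinSuccAbove (fun _ : Fin (n + 1) => μ) k).lintegral_comp hF).trans
    (lintegral_prod _ hF.aemeasurable)

theorem lintegral_pi_prod {α : Type*} [MeasurableSpace α] (μ : Measure α) [SigmaFinite μ]
    {f : α → ℝ≥0∞} (hf : Measurable f) (n : ℕ) :
    ∫⁻ x : Fin n → α, ∏ i, f (x i) ∂(Measure.pi fun _ => μ) = (∫⁻ a, f a ∂μ) ^ n := by
  induction n with
  | zero => simp
  | succ n ih =>
    have hp : Measurable fun y : Fin n → α => ∏ i, f (y i) := by fun_prop
    simp_rw [Fin.prod_univ_succAbove _ (0 : Fin (n + 1))]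
    rw [lintegral_pi_succAbove μ 0 (F := fun a y => f a * ∏ i, f (y i))
      ((hf.comp measurable_fst).mul (hp.comp measurable_snd))]
    simp_rw [lintegral_const_mul _ hp, ih]
    rw [lintegral_mul_const _ hf, pow_succ']

/-- Integrating the star of `x k`, first over the other vertices, in the case that the integral of
the function `m` of the edges over its second argument is constant. -/
theorem lintegral_pi_star {α : Type*} [MeasurableSpace α] (μ : Measure α) [SigmaFinite μ]
    {m : α → α → ℝ≥0∞} (hm : Measurable (Function.uncurry m)) {A : ℝ≥0∞}
    (hA : ∀ a, ∫⁻ y, m a y ∂μ = A) (o : α) {n : ℕ} (k : Fin (n + 1)) :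
    ∫⁻ x : Fin (n + 1) → α, (∏ j, m (x k) (x (k.succAbove j))) * m o (x k)
      ∂(Measure.pi fun _ => μ) = A ^ (n + 1) := by
  have hm1 (a : α) : Measurable (m a) := hm.comp measurable_prodMk_left
  have hp : Measurable fun z : α × (Fin n → α) => ∏ j, m z.1 (z.2 j) :=
    Finset.measurable_fun_prod _ fun j _ =>
      hm.comp (measurable_fst.prodMk ((measurable_pi_apply j).comp measurable_snd))
  rw [lintegral_pi_succAbove μ k (F := fun a y => (∏ j, m a (y j)) * m o a)
    (hp.mul ((hm1 o).comp measurable_fst))]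
  have (a : α) : ∫⁻ y : Fin n → α, (∏ j, m a (y j)) * m o a ∂(Measure.pi fun _ => μ) =
      A ^ n * m o a := by
    have hpa : Measurable fun y : Fin n → α => ∏ j, m a (y j) := hp.comp measurable_prodMk_left
    rw [lintegral_mul_const _ hpa, lintegral_pi_prod μ (hm1 a), hA]
  simp_rw [this]
  rw [lintegral_const_mul _ (hm1 o), hA, ← pow_succ]

/-- All the stars have the same integral: those at an integrated vertex by integrating first over
the other vertices, the majorant having the same integral from every point. -/
theorem lintegral_star (o : Hyp) (i : Fin 5) :
    ∫⁻ x : Fin 4 → Hyp, ∏ j : Fin 4,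
        majorant (form ((Fin.snoc x o : Fin 5 → Hyp) i).1
          ((Fin.snoc x o : Fin 5 → Hyp) (i.succAbove j)).1) ^ (5 / 2 : ℝ)
        ∂(Measure.pi fun _ => hvol) = majorantIntegral ^ 4 := by
  have hm : Measurable (Function.uncurry fun x y : Hyp => majorant (form x.1 y.1) ^ (5 / 2 : ℝ)) :=
    (measurable_majorant.comp measurable_form).pow_const _
  induction i using Fin.lastCases with
  | last =>
    simp only [Fin.snoc_last, Fin.succAbove_last, Fin.snoc_castSucc]
    rw [← lintegral_majorant o]
    exact lintegral_pi_prod hvol (hm.comp measurable_prodMk_left) 4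
  | cast k =>
    rw [← lintegral_pi_star hvol hm lintegral_majorant o k]
    refine lintegral_congr fun x => ?_
    rw [Fin.prod_univ_castSucc, Fin.succAbove_castSucc_of_le k (Fin.last 3) (Fin.le_last k),
      Fin.succ_last, form_comm]
    simp only [Fin.castSucc_succAbove_castSucc, Fin.snoc_last, Fin.snoc_castSucc]

theorem lintegral_I10Integrand_le (o : Hyp) (ρ : Fin 5 → Fin 5 → ℝ) :
    ∫⁻ x, ‖I10Integrand o ρ x‖ₑ ∂(Measure.pi fun _ : Fin 4 => hvol) ≤
      (∏ p ∈ (Finset.univ : Finset (Fin 5 × Fin 5)) with p.1 < p.2, cutoff (ρ p.1 p.2)) *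
        (5 * majorantIntegral ^ 4) := by
  have hX (i : Fin 5) : Measurable fun x : Fin 4 → Hyp => (Fin.snoc x o : Fin 5 → Hyp) i := by
    induction i using Fin.lastCases with
    | last => simp only [Fin.snoc_last]; exact measurable_const
    | cast k => simp only [Fin.snoc_castSucc]; exact measurable_pi_apply k
  have hm (i j : Fin 5) : Measurable fun x : Fin 4 → Hyp =>
      majorant (form ((Fin.snoc x o : Fin 5 → Hyp) i).1
        ((Fin.snoc x o : Fin 5 → Hyp) j).1) ^ (5 / 2 : ℝ) :=
    (measurable_majorant.comp (measurable_form.comp ((hX i).prodMk (hX j)))).pow_const _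
  have hsum : 5 * majorantIntegral ^ 4 =
      ∫⁻ x : Fin 4 → Hyp, ∑ i, ∏ j : Fin 4,
        majorant (form ((Fin.snoc x o : Fin 5 → Hyp) i).1
          ((Fin.snoc x o : Fin 5 → Hyp) (i.succAbove j)).1) ^ (5 / 2 : ℝ)
        ∂(Measure.pi fun _ => hvol) := by
    rw [lintegral_finsetSum _ fun i _ => Finset.measurable_fun_prod _ fun j _ => hm _ _]
    simp [lintegral_star]
  rw [hsum, ← lintegral_const_mul _ (Finset.measurable_fun_sum _ fun i _ =>
    Finset.measurable_fun_prod _ fun j _ => hm _ _)]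
  refine lintegral_mono fun x => ?_
  rw [I10Integrand, enorm_prod_real]
  refine (Finset.prod_le_prod' fun p _ => enorm_kernel_le _ _ _).trans ?_
  rw [Finset.prod_mul_distrib]
  gcongr
  exact prod_edges_le_sum_stars
    (fun i j => majorant (form ((Fin.snoc x o : Fin 5 → Hyp) i).1
      ((Fin.snoc x o : Fin 5 → Hyp) j).1)) fun i j => by rw [form_comm]

theorem measurable_I10Integrand (o : Hyp) :
    Measurable fun z : (Fin 5 → Fin 5 → ℝ) × (Fin 4 → Hyp) => I10Integrand o z.1 z.2 := by
  have hX (i : Fin 5) : Measurable fun x : Fin 4 → Hyp => (Fin.snoc x o : Fin 5 → Hyp) i := by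
    induction i using Fin.lastCases with
    | last => simp only [Fin.snoc_last]; exact measurable_const
    | cast k => simp only [Fin.snoc_castSucc]; exact measurable_pi_apply k
  unfold I10Integrand
  refine Finset.measurable_fun_prod _ fun p _ => Measurable.kernel ?_
    ((hX _).comp measurable_snd) ((hX _).comp measurable_snd)
  fun_prop

theorem integrable_I10Integrand (o : Hyp) (ρ : Fin 5 → Fin 5 → ℝ) :
    Integrable (I10Integrand o ρ) (Measure.pi fun _ : Fin 4 => hvol) := by
  refine ⟨((measurable_I10Integrand o).comp measurable_prodMk_left).aestronglyMeasurable, ?_⟩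
  refine (lintegral_I10Integrand_le o ρ).trans_lt (ENNReal.mul_lt_top ?_ ?_)
  · exact (Finset.prod_le_one' fun _ _ => cutoff_le_one _).trans_lt ENNReal.one_lt_top
  · exact ENNReal.mul_lt_top (by simp) (ENNReal.pow_lt_top majorantIntegral_lt_top)

theorem enorm_I10_le (o : Hyp) (ρ : Fin 5 → Fin 5 → ℝ) :
    ‖I10 o ρ‖ₑ ≤ ‖1 / (2 * Real.pi ^ 2)‖ₑ *
      ((∏ p ∈ (Finset.univ : Finset (Fin 5 × Fin 5)) with p.1 < p.2, cutoff (ρ p.1 p.2)) *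
        (5 * majorantIntegral ^ 4)) := by
  rw [I10, enorm_mul]
  gcongr
  exact (enorm_integral_le_lintegral_enorm _).trans (lintegral_I10Integrand_le o ρ)

theorem measurable_I10 (o : Hyp) : Measurable (I10 o) :=
  ((measurable_I10Integrand o).stronglyMeasurable.integral_prod_right.measurable).const_mul _

/-! ### Products over simplices and their faces -/

/-- Each `f ∈ t` has a preimage, and the factors of the other elements of `s` are at most `1`. -/
theorem prod_comp_le_prod_of_subset_image {ι κ : Type*} [DecidableEq κ] {s : Finset ι}
    {t : Finset κ} {φ : ι → κ} (h : ∀ f ∈ t, ∃ i ∈ s, φ i = f) {w : κ → ℝ≥0∞} (hw : ∀ f, w f ≤ 1) :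
    ∏ i ∈ s, w (φ i) ≤ ∏ f ∈ t, w f := by
  classical
  rcases t.eq_empty_or_nonempty with rfl | ⟨f, hf⟩
  · simpa using Finset.prod_le_one' fun i _ => hw (φ i)
  have : Nonempty ι := ⟨(h f hf).choose⟩
  choose! σ hσ hφ using h
  calc ∏ i ∈ s, w (φ i) ≤ ∏ i ∈ t.image σ, w (φ i) :=
        Finset.prod_le_prod_of_subset_of_le_one' (Finset.image_subset_iff.2 hσ) fun _ _ _ => hw _
    _ = ∏ f ∈ t, w (φ (σ f)) :=
        Finset.prod_image fun f hf g hg hfg => by rw [← hφ f hf, hfg, hφ g hg]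
    _ = ∏ f ∈ t, w f := Finset.prod_congr rfl fun f hf => by rw [hφ f hf]

/-- After exchanging the products, the factor of `f` occurs once for each simplex containing it. -/
theorem prod_prod_faces_le {V : Type*} [DecidableEq V] {S I : Finset (Finset V)} {n : ℕ}
    (h : ∀ f ∈ I, n ≤ ({e ∈ S | f ⊆ e}).card) {w : Finset V → ℝ≥0∞} (hw : ∀ f, w f ≤ 1) :
    ∏ e ∈ S, ∏ f ∈ I with f ⊆ e, w f ≤ ∏ f ∈ I, w f ^ n := by
  simp_rw [Finset.prod_filter]
  rw [Finset.prod_comm]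
  refine Finset.prod_le_prod' fun f hf => ?_
  rw [← Finset.prod_filter, Finset.prod_const]
  exact pow_le_pow_right_of_le_one' (hw f) (h f hf)

/-! ### The simplices around an internal 2-simplex -/

section Complex

variable {V : Type*} {K : PreAbstractSimplicialComplex V}

theorem mem_faces_of_subset {s t : Finset V} (ht : t ∈ K.faces) (hst : s ⊆ t)
    (hs : s.Nonempty) : s ∈ K.faces :=
  (K.isRelLowerSet_faces ht).2 hst hs

variable [Fintype V]

theorem mem_simplices {k : ℕ} {s : Finset V} :
    s ∈ simplices K k ↔ s ∈ K.faces ∧ s.card = k + 1 := by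
  simp [simplices]

theorem mem_boundaryTets [DecidableEq V] {e : Finset V} :
    e ∈ boundaryTets K ↔ e ∈ simplices K 3 ∧ ({v ∈ simplices K 4 | e ⊆ v}).card = 1 := by
  rw [boundaryTets, Finset.mem_filter]
  convert Iff.rfl

theorem mem_boundaryFaces {f : Finset V} :
    f ∈ boundaryFaces K ↔ f ∈ simplices K 2 ∧ ∃ e ∈ boundaryTets K, f ⊆ e := by
  simp [boundaryFaces]

theorem mem_internalFaces {f : Finset V} :
    f ∈ internalFaces K ↔ f ∈ simplices K 2 ∧ f ∉ boundaryFaces K := by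
  simp [internalFaces]

/-- A 3-simplex containing an internal 2-simplex is not in the boundary, so it lies in a second
4-simplex. -/
theorem exists_insert_mem_faces [DecidableEq V]
    (hK : ∀ s ∈ K.faces, ∃ t ∈ K.faces, s ⊆ t ∧ t.card = 5) {f : Finset V}
    (hf : f ∈ internalFaces K) {a : V} (ha : a ∉ f) (he : insert a f ∈ K.faces) (b : V) :
    ∃ c, c ∉ insert a f ∧ c ≠ b ∧ insert c (insert a f) ∈ K.faces := by
  obtain ⟨hf2, hfb⟩ := mem_internalFaces.1 hf
  have hcard : (insert a f).card = 4 := by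
    rw [Finset.card_insert_of_notMem ha, (mem_simplices.1 hf2).2]
  have hne : ({v ∈ simplices K 4 | insert a f ⊆ v}).card ≠ 1 := fun h1 =>
    hfb (mem_boundaryFaces.2 ⟨hf2, insert a f,
      mem_boundaryTets.2 ⟨mem_simplices.2 ⟨he, hcard⟩, h1⟩, Finset.subset_insert _ _⟩)
  obtain ⟨t, ht, het, htc⟩ := hK _ he
  have hpos : 0 < ({v ∈ simplices K 4 | insert a f ⊆ v}).card :=
    Finset.card_pos.2 ⟨t, Finset.mem_filter.2 ⟨mem_simplices.2 ⟨ht, htc⟩, het⟩⟩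
  obtain ⟨v, hv, hvb⟩ := Finset.exists_mem_ne
    (show 1 < ({v ∈ simplices K 4 | insert a f ⊆ v}).card by omega) (insert b (insert a f))
  obtain ⟨hv4, hev⟩ := Finset.mem_filter.1 hv
  obtain ⟨hvK, hvc⟩ := mem_simplices.1 hv4
  obtain ⟨c, hc, rfl⟩ := Finset.exists_eq_insert_iff.2 ⟨hev, by omega⟩
  exact ⟨c, hc, fun hcb => hvb (by rw [hcb]), hvK⟩

/-- The link of an internal 2-simplex is a nonempty graph, with the 3-simplices as its vertices and
the 4-simplices as its edges, in which every vertex has degree at least two. Such a graph has at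
least three vertices and three edges. -/
theorem three_le_card_of_mem_internalFaces [DecidableEq V]
    (hK : ∀ s ∈ K.faces, ∃ t ∈ K.faces, s ⊆ t ∧ t.card = 5) {f : Finset V}
    (hf : f ∈ internalFaces K) :
    3 ≤ ({e ∈ simplices K 3 | f ⊆ e}).card ∧ 3 ≤ ({v ∈ simplices K 4 | f ⊆ v}).card := by
  obtain ⟨hfK, hfc⟩ := mem_simplices.1 (mem_internalFaces.1 hf).1
  have hface {x : V} {s : Finset V} (h : insert x s ∈ K.faces) (hs : f ⊆ s) : insert x f ∈ K.faces :=
    mem_faces_of_subset h (Finset.insert_subset_insert _ hs) (Finset.insert_nonempty _ _)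
  -- in the link, `a` is a vertex, `b` and `c` are neighbours of `a`, and `d ≠ a` is one of `b`
  obtain ⟨t, ht, hft, htc⟩ := hK f hfK
  obtain ⟨a, hat, ha⟩ := Finset.exists_of_ssubset (hft.ssubset_of_ne (by rintro rfl; omega))
  have haK : insert a f ∈ K.faces :=
    mem_faces_of_subset ht (Finset.insert_subset hat hft) (Finset.insert_nonempty _ _)
  obtain ⟨b, hb, -, hbaK⟩ := exists_insert_mem_faces hK hf ha haK a
  obtain ⟨c, hc, hcb, hcaK⟩ := exists_insert_mem_faces hK hf ha haK b
  have hbK := hface hbaK (Finset.subset_insert _ _)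
  have hcK := hface hcaK (Finset.subset_insert _ _)
  simp only [Finset.mem_insert, not_or] at hb hc
  obtain ⟨d, hd, hda, hdbK⟩ := exists_insert_mem_faces hK hf hb.2 hbK a
  simp only [Finset.mem_insert, not_or] at hd
  have htet {x : V} (hx : x ∉ f) (hxK : insert x f ∈ K.faces) :
      insert x f ∈ ({e ∈ simplices K 3 | f ⊆ e} : Finset (Finset V)) :=
    Finset.mem_filter.2 ⟨mem_simplices.2 ⟨hxK, by rw [Finset.card_insert_of_notMem hx, hfc]⟩,
      Finset.subset_insert _ _⟩
  have hsimp {x y : V} (hy : y ∉ f) (hx : x ≠ y) (hx' : x ∉ f)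
      (hK : insert x (insert y f) ∈ K.faces) :
      insert x (insert y f) ∈ ({v ∈ simplices K 4 | f ⊆ v} : Finset (Finset V)) :=
    Finset.mem_filter.2 ⟨mem_simplices.2 ⟨hK, by
      rw [Finset.card_insert_of_notMem (by simp [hx, hx']), Finset.card_insert_of_notMem hy, hfc]⟩,
      (Finset.subset_insert _ _).trans (Finset.subset_insert _ _)⟩
  have hins {x y : V} {s : Finset V} (hx : x ≠ y) (hx' : x ∉ s) : insert x s ≠ insert y s := by
    intro h
    have := h ▸ Finset.mem_insert_self x s
    simp [hx, hx'] at this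
  constructor
  · exact Finset.two_lt_card.2 ⟨_, htet ha haK, _, htet hb.2 hbK, _, htet hc.2 hcK,
      hins (Ne.symm hb.1) ha, hins (Ne.symm hc.1) ha, hins (Ne.symm hcb) hb.2⟩
  · have hbd {x : V} : insert d (insert b f) ≠ insert x (insert a f) := by
      intro h
      have : a ∈ insert d (insert b f) := h ▸ by simp
      simp [Ne.symm hda, Ne.symm hb.1, ha] at this
    exact Finset.two_lt_card.2 ⟨_, hsimp ha hb.1 hb.2 hbaK, _, hsimp ha hc.1 hc.2 hcaK,
      _, hsimp hb.2 hd.1 hd.2 hdbK, hins (Ne.symm hcb) (by simp [hb.1, hb.2]), hbd.symm, hbd.symm⟩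

/-! ### Products over the internal 2-simplices of a simplex -/

theorem prod_tet_faces_le [LinearOrder V] {e : Finset V} (he : e.card = 4) {w : Finset V → ℝ≥0∞}
    (hw : ∀ f, w f ≤ 1) :
    ∏ i, w (e.erase (e.orderEmbOfFin he i)) ≤ ∏ f ∈ internalFaces K with f ⊆ e, w f := by
  refine prod_comp_le_prod_of_subset_image (fun f hf => ?_) hw
  obtain ⟨hf, hfe⟩ := Finset.mem_filter.1 hf
  have hfc := (mem_simplices.1 (mem_internalFaces.1 hf).1).2
  obtain ⟨a, ha, rfl⟩ := Finset.exists_eq_insert_iff.2 ⟨hfe, by omega⟩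
  have : a ∈ Set.range ((insert a f).orderEmbOfFin he) := by
    simp [Finset.range_orderEmbOfFin]
  obtain ⟨i, hi⟩ := this
  exact ⟨i, Finset.mem_univ _, by rw [hi, Finset.erase_insert ha]⟩

theorem prod_simplex_faces_le [LinearOrder V] {v : Finset V} (hv : v.card = 5)
    {w : Finset V → ℝ≥0∞} (hw : ∀ f, w f ≤ 1) :
    ∏ p ∈ (Finset.univ : Finset (Fin 5 × Fin 5)) with p.1 < p.2,
        w ((v.erase (v.orderEmbOfFin hv p.1)).erase (v.orderEmbOfFin hv p.2)) ≤
      ∏ f ∈ internalFaces K with f ⊆ v, w f := by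
  refine prod_comp_le_prod_of_subset_image
    (φ := fun p : Fin 5 × Fin 5 =>
      (v.erase (v.orderEmbOfFin hv p.1)).erase (v.orderEmbOfFin hv p.2)) (fun f hf => ?_) hw
  obtain ⟨hf, hfv⟩ := Finset.mem_filter.1 hf
  have hfc := (mem_simplices.1 (mem_internalFaces.1 hf).1).2
  obtain ⟨x, y, hxy, hvf⟩ := Finset.card_eq_two.1
    (show (v \ f).card = 2 by rw [Finset.card_sdiff_of_subset hfv]; omega)
  have hmem (z : V) (hz : z ∈ v \ f) : ∃ i, v.orderEmbOfFin hv i = z := by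
    have : z ∈ Set.range (v.orderEmbOfFin hv) := by
      rw [Finset.range_orderEmbOfFin]
      exact (Finset.mem_sdiff.1 hz).1
    exact this
  obtain ⟨i, hi⟩ := hmem x (by simp [hvf])
  obtain ⟨j, hj⟩ := hmem y (by simp [hvf])
  have hfxy : f = (v.erase x).erase y := by
    rw [← Finset.sdiff_sdiff_eq_self hfv, hvf]
    ext z
    simp only [Finset.mem_sdiff, Finset.mem_insert, Finset.mem_singleton, Finset.mem_erase]
    tauto
  rcases lt_trichotomy i j with hij | hij | hij
  · exact ⟨(i, j), by simp [hij], by simp only [hi, hj, hfxy]⟩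
  · exact absurd (hi.symm.trans ((congrArg _ hij).trans hj)) hxy
  · exact ⟨(j, i), by simp [hij], by simp only [hi, hj, hfxy, Finset.erase_right_comm]⟩

end Complex

/-! ### The integral over one label -/

/-- The bound for the integrand of the state sum as a function of one internal label: the face
amplitude `r²`, and the decay from three 4-simplices and from three 3-simplices. -/
noncomputable def labelBound (r : ℝ) : ℝ≥0∞ :=
  ‖r ^ 2‖ₑ * ((cutoff r ^ 3) ^ (5 / 8 : ℝ) * cutoff r ^ 3)

theorem measurable_labelBound : Measurable labelBound := by
  have := measurable_cutoff
  unfold labelBound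
  fun_prop

theorem labelBound_le_of_le_one {r : ℝ} (h0 : 0 < r) (h1 : r ≤ 1) : labelBound r ≤ 1 := by
  have h : cutoff r ^ 3 ≤ 1 := pow_le_one' (cutoff_le_one r) 3
  refine mul_le_one' ?_ (mul_le_one' (ENNReal.rpow_le_one h (by norm_num)) h)
  rw [Real.enorm_eq_ofReal (by positivity), ENNReal.ofReal_le_one]
  exact pow_le_one₀ h0.le h1

theorem labelBound_of_one_lt {r : ℝ} (h : 1 < r) :
    labelBound r = ENNReal.ofReal (r ^ (-23 / 8 : ℝ)) := by
  have h0 : 0 < r := zero_lt_one.trans h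
  have hc : cutoff r ^ 3 = ENNReal.ofReal (r ^ (-3 : ℝ)) := by
    rw [cutoff_eq_ofReal h0, min_eq_right (inv_le_one_of_one_le₀ h.le),
      ← ENNReal.ofReal_pow (by positivity), Real.rpow_neg h0.le, inv_pow]
    norm_cast
  rw [labelBound, hc, Real.enorm_eq_ofReal (by positivity),
    ENNReal.ofReal_rpow_of_nonneg (by positivity) (by norm_num), ← Real.rpow_mul h0.le,
    ← ENNReal.ofReal_mul (by positivity), ← ENNReal.ofReal_mul (by positivity),
    ← Real.rpow_add h0, ← Real.rpow_natCast, ← Real.rpow_add h0]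
  norm_num

/-- Convergence holds with room to spare: the exponent at infinity is `2 - 3 - 15/8 < -1`. -/
theorem lintegral_labelBound_lt_top : ∫⁻ r in Set.Ioi 0, labelBound r < ∞ := by
  rw [← Set.Ioc_union_Ioi_eq_Ioi zero_le_one]
  refine (lintegral_union_le _ _ _).trans_lt (ENNReal.add_lt_top.2 ⟨?_, ?_⟩)
  · refine (setLIntegral_mono measurable_const
      fun r hr => labelBound_le_of_le_one hr.1 hr.2).trans_lt ?_
    simp
  · rw [setLIntegral_congr_fun measurableSet_Ioi fun r hr => labelBound_of_one_lt hr]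
    exact (integrableOn_Ioi_rpow_of_lt (by norm_num) zero_lt_one).lintegral_lt_top

theorem lintegral_prod_labelBound_lt_top (ι : Type*) [Fintype ι] :
    ∫⁻ ρ in {ρ : ι → ℝ | ∀ i, 0 < ρ i}, ∏ i, labelBound (ρ i) < ∞ := by
  have hset : {ρ : ι → ℝ | ∀ i, 0 < ρ i} = Set.univ.pi fun _ => Set.Ioi 0 := by
    ext; simp
  have hint : Integrable (fun r => (labelBound r).toReal) (volume.restrict (Set.Ioi 0)) :=
    integrable_toReal_of_lintegral_ne_top measurable_labelBound.aemeasurable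
      lintegral_labelBound_lt_top.ne
  have htop (r) : labelBound r ≠ ∞ := by
    have hc : cutoff r ^ 3 ≤ 1 := pow_le_one' (cutoff_le_one r) 3
    exact ENNReal.mul_ne_top enorm_ne_top (ENNReal.mul_ne_top
      (ne_top_of_le_ne_top ENNReal.one_ne_top (ENNReal.rpow_le_one hc (by norm_num)))
      (ne_top_of_le_ne_top ENNReal.one_ne_top hc))
  rw [hset, volume_pi, Measure.restrict_pi_pi]
  refine lt_of_eq_of_lt (lintegral_congr fun ρ => ?_)
    (Integrable.fintype_prod (ι := ι) fun _ => hint).hasFiniteIntegral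
  rw [enorm_prod_real]
  refine Finset.prod_congr rfl fun i _ => ?_
  rw [Real.enorm_eq_ofReal ENNReal.toReal_nonneg, ENNReal.ofReal_toReal (htop _)]

/-! ### The state sum -/

section StateSum

variable {V : Type*} [Fintype V] {K : PreAbstractSimplicialComplex V}

theorem measurable_label (β : boundaryFaces K → ℝ) (f : Finset V) :
    Measurable fun ρ => label K β ρ f := by
  unfold label
  split_ifs
  · exact measurable_pi_apply _
  · exact measurable_const
  · exact measurable_const

theorem measurable_stateSumIntegrand [LinearOrder V] (o : Hyp) (β : boundaryFaces K → ℝ) :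
    Measurable (stateSumIntegrand K o β) := by
  have hl := measurable_label (K := K) β
  unfold stateSumIntegrand
  refine ((Finset.measurable_fun_prod _ fun f _ => (hl f).pow_const 2).mul
    (Finset.measurable_fun_prod _ fun e _ => ?_)).mul
    (Finset.measurable_fun_prod _ fun v _ => ?_)
  · exact (measurable_theta4 o).comp (measurable_pi_lambda _ fun i => hl _)
  · exact (measurable_I10 o).comp
      (measurable_pi_lambda _ fun i => measurable_pi_lambda _ fun j => hl _)

theorem prod_enorm_tetAmplitude_le [LinearOrder V] (o : Hyp) (l : Finset V → ℝ)
    (hK : ∀ f ∈ internalFaces K, 3 ≤ ({e ∈ simplices K 3 | f ⊆ e}).card) :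
    ∏ e : simplices K 3, ‖tetAmplitude o l e.1 (card_of_mem_simplices e.2)‖ₑ ≤
      (‖1 / (2 * Real.pi ^ 2)‖ₑ * majorantIntegral) ^ (simplices K 3).card *
        ∏ f ∈ internalFaces K, (cutoff (l f) ^ 3) ^ (5 / 8 : ℝ) := by
  calc _ ≤ ∏ e : simplices K 3, (‖1 / (2 * Real.pi ^ 2)‖ₑ * majorantIntegral) *
          (∏ f ∈ internalFaces K with f ⊆ e.1, cutoff (l f)) ^ (5 / 8 : ℝ) := by
        refine Finset.prod_le_prod' fun e _ => (enorm_theta4_le o _).trans ?_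
        rw [mul_assoc, mul_comm majorantIntegral]
        gcongr
        exact prod_tet_faces_le (w := fun f => cutoff (l f)) _ fun f => cutoff_le_one _
    _ = (‖1 / (2 * Real.pi ^ 2)‖ₑ * majorantIntegral) ^ (simplices K 3).card *
          (∏ e ∈ simplices K 3, ∏ f ∈ internalFaces K with f ⊆ e, cutoff (l f)) ^ (5 / 8 : ℝ) := by
        rw [Finset.prod_mul_distrib, Finset.prod_const, Finset.card_univ, Fintype.card_coe,
          ENNReal.prod_rpow_of_nonneg (by norm_num), Finset.prod_coe_sort (simplices K 3)
            fun e => ∏ f ∈ internalFaces K with f ⊆ e, cutoff (l f)]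
    _ ≤ _ := by
        rw [ENNReal.prod_rpow_of_nonneg (by norm_num)]
        gcongr
        exact prod_prod_faces_le hK (w := fun f => cutoff (l f)) fun f => cutoff_le_one _

theorem prod_enorm_simplexAmplitude_le [LinearOrder V] (o : Hyp) (l : Finset V → ℝ)
    (hK : ∀ f ∈ internalFaces K, 3 ≤ ({v ∈ simplices K 4 | f ⊆ v}).card) :
    ∏ v : simplices K 4, ‖simplexAmplitude o l v.1 (card_of_mem_simplices v.2)‖ₑ ≤
      (‖1 / (2 * Real.pi ^ 2)‖ₑ * (5 * majorantIntegral ^ 4)) ^ (simplices K 4).card *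
        ∏ f ∈ internalFaces K, cutoff (l f) ^ 3 := by
  calc _ ≤ ∏ v : simplices K 4, (‖1 / (2 * Real.pi ^ 2)‖ₑ * (5 * majorantIntegral ^ 4)) *
          ∏ f ∈ internalFaces K with f ⊆ v.1, cutoff (l f) := by
        refine Finset.prod_le_prod' fun v _ => (enorm_I10_le o _).trans ?_
        rw [mul_assoc, mul_comm (5 * majorantIntegral ^ 4)]
        gcongr
        exact prod_simplex_faces_le (w := fun f => cutoff (l f)) _ fun f => cutoff_le_one _
    _ = (‖1 / (2 * Real.pi ^ 2)‖ₑ * (5 * majorantIntegral ^ 4)) ^ (simplices K 4).card *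
          ∏ v ∈ simplices K 4, ∏ f ∈ internalFaces K with f ⊆ v, cutoff (l f) := by
        rw [Finset.prod_mul_distrib, Finset.prod_const, Finset.card_univ, Fintype.card_coe,
          Finset.prod_coe_sort (simplices K 4)
            fun v => ∏ f ∈ internalFaces K with f ⊆ v, cutoff (l f)]
    _ ≤ _ := by
        gcongr
        exact prod_prod_faces_le hK (w := fun f => cutoff (l f)) fun f => cutoff_le_one _

theorem label_of_mem_internalFaces (β : boundaryFaces K → ℝ) (ρ : internalFaces K → ℝ)
    (f : internalFaces K) : label K β ρ f = ρ f := by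
  simp [label]

theorem label_of_mem_boundaryFaces (β : boundaryFaces K → ℝ) (ρ ρ' : internalFaces K → ℝ)
    {f : Finset V} (hf : f ∈ boundaryFaces K) : label K β ρ f = label K β ρ' f := by
  have : f ∉ internalFaces K := fun h => (mem_internalFaces.1 h).2 hf
  simp [label, this]

/-- The face amplitudes of the boundary do not depend on the internal labels, which may be set to
`0` there. -/
theorem prod_enorm_label_sq [DecidableEq V] (β : boundaryFaces K → ℝ) (ρ : internalFaces K → ℝ) :
    ‖∏ f ∈ simplices K 2, label K β ρ f ^ 2‖ₑ =
      ‖∏ f ∈ simplices K 2 with f ∈ boundaryFaces K, label K β 0 f ^ 2‖ₑ *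
        ∏ f ∈ internalFaces K, ‖label K β ρ f ^ 2‖ₑ := by
  rw [← Finset.prod_filter_mul_prod_filter_not (simplices K 2) (· ∈ boundaryFaces K), enorm_mul]
  congr 1
  · congr 1
    refine Finset.prod_congr rfl fun f hf => ?_
    rw [label_of_mem_boundaryFaces β ρ 0 (Finset.mem_filter.1 hf).2]
  · rw [enorm_prod_real]
    refine Finset.prod_congr ?_ fun _ _ => rfl
    ext f
    simp [mem_internalFaces]

theorem integrableOn_stateSumIntegrand [LinearOrder V]
    (hK : ∀ s ∈ K.faces, ∃ t ∈ K.faces, s ⊆ t ∧ t.card = 5) (o : Hyp)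
    (β : boundaryFaces K → ℝ) :
    IntegrableOn (stateSumIntegrand K o β) {ρ | ∀ f, 0 < ρ f} := by
  refine ⟨(measurable_stateSumIntegrand o β).aestronglyMeasurable, ?_⟩
  set A := ‖∏ f ∈ simplices K 2 with f ∈ boundaryFaces K, label K β 0 f ^ 2‖ₑ
  set B := (‖1 / (2 * Real.pi ^ 2)‖ₑ * majorantIntegral) ^ (simplices K 3).card
  set C := (‖1 / (2 * Real.pi ^ 2)‖ₑ * (5 * majorantIntegral ^ 4)) ^ (simplices K 4).card
  have hBtop : B ≠ ∞ :=
    ENNReal.pow_ne_top (ENNReal.mul_ne_top enorm_ne_top majorantIntegral_lt_top.ne)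
  have hCtop : C ≠ ∞ :=
    ENNReal.pow_ne_top (ENNReal.mul_ne_top enorm_ne_top
      (ENNReal.mul_ne_top (by simp) (ENNReal.pow_ne_top majorantIntegral_lt_top.ne)))
  have hbound (ρ : internalFaces K → ℝ) :
      ‖stateSumIntegrand K o β ρ‖ₑ ≤ A * B * C * ∏ f, labelBound (ρ f) := by
    rw [stateSumIntegrand, enorm_mul, enorm_mul, enorm_prod_real (Finset.univ : Finset _),
      enorm_prod_real (Finset.univ : Finset _), prod_enorm_label_sq]
    have h3 := prod_enorm_tetAmplitude_le o (label K β ρ) (K := K)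
      fun f hf => (three_le_card_of_mem_internalFaces hK hf).1
    have h4 := prod_enorm_simplexAmplitude_le o (label K β ρ) (K := K)
      fun f hf => (three_le_card_of_mem_internalFaces hK hf).2
    refine (mul_le_mul' (mul_le_mul_right h3 _) h4).trans_eq ?_
    have : ∏ f, labelBound (ρ f) = ∏ f ∈ internalFaces K, labelBound (label K β ρ f) := by
      rw [← Finset.prod_coe_sort (internalFaces K) fun f => labelBound (label K β ρ f)]
      exact Finset.prod_congr rfl fun f _ => by rw [label_of_mem_internalFaces]
    rw [this]
    simp only [labelBound, Finset.prod_mul_distrib]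
    ring
  have hm : Measurable fun ρ : internalFaces K → ℝ => ∏ f, labelBound (ρ f) :=
    Finset.measurable_fun_prod _ fun f _ => measurable_labelBound.comp (measurable_pi_apply f)
  refine (lintegral_mono hbound).trans_lt ?_
  rw [lintegral_const_mul _ hm]
  exact ENNReal.mul_lt_top
    (ENNReal.mul_ne_top (ENNReal.mul_ne_top enorm_ne_top hBtop) hCtop).lt_top
    (lintegral_prod_labelBound_lt_top _)

end StateSum

end LorentzianBC

theorem mainTheorem1 {V : Type*} [Fintype V] [LinearOrder V] {M : Type*} [TopologicalSpace M]
    [ChartedSpace (EuclideanHalfSpace 4) M] (K : PreAbstractSimplicialComplex V)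
    (hK : LorentzianBC.IsTriangulation K M) (o : LorentzianBC.Hyp) :
    (∀ ρ : Fin 4 → ℝ, (∀ i, 0 < ρ i) →
      MeasureTheory.Integrable (LorentzianBC.thetaIntegrand o ρ) LorentzianBC.hvol) ∧
    (∀ ρ : Fin 5 → Fin 5 → ℝ, (∀ i j, i < j → 0 < ρ i j) →
      MeasureTheory.Integrable (LorentzianBC.I10Integrand o ρ)
        (MeasureTheory.Measure.pi fun _ : Fin 4 => LorentzianBC.hvol)) ∧
    ∀ β : LorentzianBC.boundaryFaces K → ℝ, (∀ f, 0 < β f) →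
      MeasureTheory.IntegrableOn (LorentzianBC.stateSumIntegrand K o β)
        {ρ | ∀ f, 0 < ρ f} :=
  ⟨fun ρ _ => LorentzianBC.integrable_thetaIntegrand o ρ,
    fun ρ _ => LorentzianBC.integrable_I10Integrand o ρ,
    fun β _ => LorentzianBC.integrableOn_stateSumIntegrand hK.pure o β⟩
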